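/- Assume the generalized continuum hypothesis: $2^{\mu}=\mu^{+}$ for every infinite cardinal $\mu$. Let $\kappa$ be an infinite cardinal and let $\Pi_\kappa$ be the lattice of all partitions of a set $S$ of cardinality $\kappa$, ordered by refinement ($P\le Q$ if every block of $P$ is contained in a block of $Q$), with least element $\bot=\{\{x\}: x\in S\}$ and greatest element $\top=\{S\}$. For $P\in\Pi_\kappa$ let $\mathrm{compl}(P)=\{Q\in\Pi_\kappa : P\vee Q=\top \text{ and } P\wedge Q=\bot\}$ be the set of complements of $P$. Let $P\in\Pi_\kappa$ with $P\notin\{\bot,\top\}$. Then $|\mathrm{compl}(P)|=\kappa$ if and only if exactly one block $\bar B\in P$ has $|\bar B|=\kappa$, and this block satisfies $|S\setminus\bar B|<\operatorname{cf}\kappa$. If this condition does not hold, then $|\mathrm{compl}(P)|=2^{\kappa}$. -/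

import Mathlib

universe u

/-- The generalized continuum hypothesis (for the cardinals of the universe `u`):
`2 ^ c` is the cardinal successor of `c`, for every infinite cardinal `c`. -/
def GCH : Prop :=
  ∀ c : Cardinal.{u}, Cardinal.aleph0 ≤ c → (2 : Cardinal.{u}) ^ c = Order.succ c

/-- The set of complements of a partition `P` in the lattice of all partitions of `α`, ordered by
refinement (`P ≤ Q` if every block of `P` is contained in a block of `Q`). -/
def complements {α : Type u} (P : Setoid.Partitions α) : Set (Setoid.Partitions α) :=
  {Q | P ⊔ Q = ⊤ ∧ P ⊓ Q = ⊥}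

/-! A complement of P meets each block B in at most one point per class, so its trace on Bᶜ and the
point of B, if any, attached to each point of Bᶜ determine it. With |B| = κ and c = |Bᶜ| < cf κ,
this leaves at most (2^c · κ)^c ≤ κ complements under GCH. Otherwise many complements are built as
kernels of maps. With κ blocks there are 2^κ. If |B| = κ and c ≥ cf κ, there are at least κ^c > κ.
If blocks are fewer than κ and all smaller than κ, their sizes are unbounded below κ, and König's
theorem gives more than κ transversals. By GCH, more than κ means 2^κ. -/

open Cardinal

/-- The complements of an equivalence relation in the lattice of all equivalence relations. -/
def Setoid.complements {α : Type u} (s : Setoid α) : Set (Setoid α) :=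
  {r | IsCompl s r}

theorem mk_complements_eq {α : Type u} (P : Setoid.Partitions α) :
    #(complements P) = #(Setoid.complements ((Setoid.Partition.orderIso α).symm P)) := by
  refine Cardinal.mk_congr (Equiv.subtypeEquiv (Setoid.Partition.orderIso α).symm.toEquiv ?_)
  intro Q
  change _ ↔ IsCompl _ _
  have := (Setoid.Partition.orderIso α).symm.isCompl_iff (x := P) (y := Q)
  erw [← this]
  rw [isCompl_iff, disjoint_iff, codisjoint_iff]
  exact and_comm

/-! ### Complements as kernels, and lower bounds -/

theorem Setoid.isCompl_ker {α β : Type*} {s : Setoid α} {F : α → β}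
    (hinj : ∀ x y, s x y → F x = F y → x = y)
    (hcon : ∀ u : Setoid α, s ≤ u → Setoid.ker F ≤ u → ∀ x y, u x y) :
    IsCompl s (Setoid.ker F) := by
  rw [isCompl_iff, disjoint_iff, codisjoint_iff]
  refine ⟨eq_bot_iff.2 fun x y h => hinj x y h.1 h.2, Setoid.eq_top_iff.2 fun x y => ?_⟩
  exact hcon _ le_sup_left le_sup_right x y

-- Collapsing a transversal to one class and leaving all other points alone gives a complement. As
-- there are at least two blocks, that class is not a singleton, so it can be recovered.
open Classical in
theorem Setoid.mk_pi_le_complements {α : Type u} (s : Setoid α) (hs : s ≠ ⊤) :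
    #(∀ q : Quotient s, {x : α // (⟦x⟧ : Quotient s) = q}) ≤ #s.complements := by
  let F : (∀ q : Quotient s, {x : α // (⟦x⟧ : Quotient s) = q}) → α → Option α :=
    fun t x => if x = t ⟦x⟧ then none else some x
  have hF : ∀ t q, F t (t q) = none := by
    intro t q
    have : (⟦(t q).1⟧ : Quotient s) = q := (t q).2
    simp only [F]
    rw [if_pos]
    rw [this]
  have hF' : ∀ t x, F t x = none → x = t ⟦x⟧ := by
    intro t x h
    by_contra hx
    simp [F, hx] at h
  refine Cardinal.mk_le_of_injective (f := fun t => ⟨Setoid.ker (F t), ?_⟩) ?_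
  · refine Setoid.isCompl_ker ?_ ?_
    · intro x y hxy h
      have hq : (⟦x⟧ : Quotient s) = ⟦y⟧ := Quotient.sound hxy
      by_cases hx : x = t ⟦x⟧
      · have h1 : F t x = none := if_pos hx
        have hy := hF' t y (h ▸ h1)
        rw [hx, hy, hq]
      · have h1 : F t x = some x := if_neg hx
        by_cases hy : y = t ⟦y⟧
        · have h2 : F t y = none := if_pos hy
          simp [h1, h2] at h
        · have h2 : F t y = some y := if_neg hy
          simpa [h1, h2] using h
    · intro w hsw hrw x y
      have key : ∀ z, w z (t ⟦z⟧) := fun z =>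
        hsw (Quotient.exact (t ⟦z⟧).2.symm)
      refine w.trans (key x) (w.trans (hrw ?_) (w.symm (key y)))
      change F t _ = F t _
      rw [hF, hF]
  · intro t t' h
    have h : Setoid.ker (F t) = Setoid.ker (F t') := congrArg Subtype.val h
    funext q
    obtain ⟨q', hq'⟩ : ∃ q', q' ≠ q := by
      by_contra! hq
      refine hs (Setoid.eq_top_iff.2 fun x y => Quotient.exact ?_)
      rw [hq ⟦x⟧, hq ⟦y⟧]
    have h1 : Setoid.ker (F t) (t q) (t q') := by
      change F t _ = F t _
      rw [hF, hF]
    rw [h] at h1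
    have h1 : F t' (t q) = F t' (t q') := h1
    have hne : (t q).1 ≠ (t q').1 := by
      intro he
      apply hq'
      rw [← (t q).2, ← (t q').2, he]
    -- `F t'` is injective away from the value `none`, so two distinct points can share no other
    -- value.
    have h2 : F t' (t q) = none := by
      by_contra hn
      have e1 : F t' (t q) = some (t q).1 := by
        by_contra h3; simp only [F] at hn h3; split_ifs at hn h3 <;> simp_all
      have e2 : F t' (t q') = some (t q').1 := by
        rw [h1] at hn
        by_contra h3; simp only [F] at hn h3; split_ifs at hn h3 <;> simp_all
      rw [e1, e2] at h1
      exact hne (Option.some.inj h1)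
    have h3 := hF' _ _ h2
    rw [(t q).2] at h3
    exact Subtype.ext h3

-- Fix distinct equivalent points `a` and `b`. The representative of every other block is glued to
-- `a` or to `b`, independently: `X` records the blocks glued to `a`.
open Classical in
theorem Setoid.two_power_mk_quotient_le_complements {α : Type u} (s : Setoid α) (hs : s ≠ ⊥)
    (hinf : Cardinal.aleph0 ≤ #(Quotient s)) :
    2 ^ #(Quotient s) ≤ #s.complements := by
  obtain ⟨a, b, hab, hne⟩ : ∃ a b, s a b ∧ a ≠ b := by
    by_contra! h
    exact hs (eq_bot_iff.2 fun x y hxy => h x y hxy)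
  have hcard : #(Quotient s) = #{q : Quotient s // q ≠ ⟦a⟧} := by
    have : Infinite (Quotient s) := Cardinal.infinite_iff.2 hinf
    have h1 := Cardinal.mk_compl_of_infinite ({⟦a⟧} : Set (Quotient s))
      (by rw [Cardinal.mk_singleton]; exact Cardinal.one_lt_aleph0.trans_le hinf)
    exact h1.symm
  have hba : (⟦b⟧ : Quotient s) = ⟦a⟧ := Quotient.sound (s.symm hab)
  rw [hcard, ← Cardinal.mk_set]
  let t : Quotient s → α := Quotient.out
  have ht : ∀ q, (⟦t q⟧ : Quotient s) = q := Quotient.out_eq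
  let F : Set {q : Quotient s // q ≠ ⟦a⟧} → α → α := fun X x =>
    if h : (⟦x⟧ : Quotient s) ≠ ⟦a⟧ then
      if x = t ⟦x⟧ then (if ⟨⟦x⟧, h⟩ ∈ X then a else b) else x
    else x
  have hFid : ∀ X x, (⟦x⟧ : Quotient s) = ⟦a⟧ → F X x = x := by
    intro X x hx
    simp [F, hx]
  have hFt : ∀ X (q : {q : Quotient s // q ≠ ⟦a⟧}), F X (t q) = if q ∈ X then a else b := by
    intro X q
    simp [F, ht, q.2]
  have hFn : ∀ X x, x ≠ t ⟦x⟧ → F X x = x := by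
    intro X x hx
    simp [F, hx]
  refine Cardinal.mk_le_of_injective (f := fun X => ⟨Setoid.ker (F X), ?_⟩) ?_
  · refine Setoid.isCompl_ker ?_ ?_
    · intro x y hxy h
      have hq : (⟦x⟧ : Quotient s) = ⟦y⟧ := Quotient.sound hxy
      by_cases hx : (⟦x⟧ : Quotient s) = ⟦a⟧
      · rwa [hFid X x hx, hFid X y (hq ▸ hx)] at h
      have aux : ∀ z w, (⟦z⟧ : Quotient s) ≠ ⟦a⟧ → (⟦z⟧ : Quotient s) = ⟦w⟧ → F X z = F X w →
          z = t ⟦z⟧ → w = t ⟦w⟧ := by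
        intro z w hz hzw h h1
        by_contra h2
        rw [hFn X w h2, h1, hFt X ⟨⟦z⟧, hz⟩] at h
        apply hz
        rw [hzw, ← h]
        split_ifs
        · rfl
        · exact hba
      by_cases h1 : x = t ⟦x⟧
      · rw [h1, aux x y hx hq h h1, hq]
      · by_cases h2 : y = t ⟦y⟧
        · exact absurd (aux y x (hq ▸ hx) hq.symm h.symm h2) h1
        · rwa [hFn X x h1, hFn X y h2] at h
    · intro w hsw hrw x y
      suffices key : ∀ z, w z a from w.trans (key x) (w.symm (key y))
      intro z
      by_cases hz : (⟦z⟧ : Quotient s) = ⟦a⟧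
      · exact hsw (Quotient.exact hz)
      · refine w.trans (hsw (Quotient.exact (ht ⟦z⟧).symm)) ?_
        have h1 := hFt X ⟨⟦z⟧, hz⟩
        split_ifs at h1
        · refine hrw ?_
          change F X _ = F X _
          rw [h1, hFid X a rfl]
        · refine w.trans (hrw (y := b) ?_) (hsw (s.symm hab))
          change F X _ = F X _
          rw [h1, hFid X b hba]
  · intro X Y h
    have h : Setoid.ker (F X) = Setoid.ker (F Y) := congrArg Subtype.val h
    have aux : ∀ X q, q ∈ X ↔ Setoid.ker (F X) (t q.1) a := by
      intro X q
      change _ ↔ F X _ = F X _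
      rw [hFt, hFid X a rfl]
      split_ifs with h
      · simp [h]
      · simp [h, hne.symm]
    ext q
    rw [aux X, aux Y, h]

-- Each `x` outside `B` is glued to the point `e (g x, x)` of `B`. Since `e` is injective, the
-- coordinate `x` keeps outside points apart, and the partner of `x` reveals `g x`.
open Classical in
theorem Setoid.mk_power_mk_compl_le_complements {α : Type u} (s : Setoid α) (b : α)
    (hα : Cardinal.aleph0 ≤ #α) (hb : #{x | s x b} = #α) :
    #α ^ #({x | s x b}ᶜ : Set α) ≤ #s.complements := by
  set B : Set α := {x | s x b}
  have hle : #(B × (Bᶜ : Set α)) ≤ #B := by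
    rw [Cardinal.mk_prod, Cardinal.lift_id, Cardinal.lift_id, hb]
    exact (mul_le_mul_right (Cardinal.mk_set_le _) _).trans (Cardinal.mul_eq_self hα).le
  obtain ⟨e⟩ := Cardinal.le_def _ _ |>.1 hle
  rw [← hb, Cardinal.power_def]
  let F : ((Bᶜ : Set α) → B) → α → α := fun g x => if h : x ∈ B then x else e (g ⟨x, h⟩, ⟨x, h⟩)
  have hF1 : ∀ g x, x ∈ B → F g x = x := fun g x h => dif_pos h
  have hF2 : ∀ g (x : (Bᶜ : Set α)), F g x = e (g x, x) := fun g x => dif_neg x.2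
  refine Cardinal.mk_le_of_injective (f := fun g => ⟨Setoid.ker (F g), ?_⟩) ?_
  · refine Setoid.isCompl_ker ?_ ?_
    · intro x y hxy h
      by_cases hx : x ∈ B
      · have hy : y ∈ B := s.trans (s.symm hxy) hx
        rwa [hF1 g x hx, hF1 g y hy] at h
      · have hy : y ∉ B := fun hy => hx (s.trans hxy hy)
        rw [hF2 g ⟨x, hx⟩, hF2 g ⟨y, hy⟩] at h
        have := e.injective (Subtype.ext h)
        exact congrArg Subtype.val (congrArg Prod.snd this)
    · intro w hsw hrw x y
      suffices key : ∀ z, w z b from w.trans (key x) (w.symm (key y))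
      intro z
      by_cases hz : z ∈ B
      · exact hsw hz
      · refine w.trans (hrw (y := e (g ⟨z, hz⟩, ⟨z, hz⟩)) ?_) (hsw (e _).2)
        change F g _ = F g _
        rw [hF2 g ⟨z, hz⟩, hF1 g _ (e _).2]
  · intro g g' h
    have h : Setoid.ker (F g) = Setoid.ker (F g') := congrArg Subtype.val h
    funext x
    have h1 : Setoid.ker (F g) x (e (g x, x)) := by
      change F g _ = F g _
      rw [hF2, hF1 g _ (e _).2]
    rw [h] at h1
    have h1 : F g' _ = F g' _ := h1
    rw [hF2, hF1 g' _ (e _).2] at h1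
    exact (congrArg Prod.fst (e.injective (Subtype.ext h1))).symm

/-! ### Upper bounds -/

open Classical in
theorem Setoid.mk_complements_le {α : Type u} (s : Setoid α) (b : α) :
    #s.complements ≤ (2 ^ #({x | s x b}ᶜ : Set α) * (#α + 1)) ^ #({x | s x b}ᶜ : Set α) := by
  set B : Set α := {x | s x b}
  have : (2 ^ #(Bᶜ : Set α) * (#α + 1)) ^ #(Bᶜ : Set α) =
      #((Bᶜ : Set α) → Set (Bᶜ : Set α) × Option α) := by
    simp
  rw [this]
  refine Cardinal.mk_le_of_injective (f := fun r c =>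
    ({d | r.1 c d}, if h : ∃ y ∈ B, r.1 c y then some h.choose else none)) ?_
  intro r r' h
  have hdis : ∀ r : s.complements, ∀ x y, x ∈ B → y ∈ B → r.1 x y → x = y := by
    intro r x y hx hy hr
    have h1 : s ⊓ r.1 ≤ ⊥ := (IsCompl.disjoint r.2).le_bot
    exact h1 (show (s ⊓ r.1) x y from ⟨s.trans hx (s.symm hy), hr⟩)
  have key : ∀ r r' : s.complements,
      (fun c : (Bᶜ : Set α) => (({d | r.1 c d} : Set (Bᶜ : Set α)),
        if h : ∃ y ∈ B, r.1 c y then some h.choose else none)) =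
      (fun c : (Bᶜ : Set α) => (({d | r'.1 c d} : Set (Bᶜ : Set α)),
        if h : ∃ y ∈ B, r'.1 c y then some h.choose else none)) → r.1 ≤ r'.1 := by
    intro r r' h
    have h1 : ∀ x y, x ∉ B → y ∈ B → r.1 x y → r'.1 x y := by
      intro x y hx hy hr
      have h2 := congrArg Prod.snd (congrFun h ⟨x, hx⟩)
      have h3 : ∃ y ∈ B, r.1 x y := ⟨y, hy, hr⟩
      have h4 : y = h3.choose := hdis r _ _ hy h3.choose_spec.1
        (r.1.trans (r.1.symm hr) h3.choose_spec.2)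
      simp only [dif_pos h3] at h2
      by_cases h5 : ∃ y ∈ B, r'.1 x y
      · simp only [dif_pos h5] at h2
        rw [h4, Option.some.inj h2]
        exact h5.choose_spec.2
      · simp [dif_neg h5] at h2
    intro x y hr
    by_cases hx : x ∈ B <;> by_cases hy : y ∈ B
    · rw [hdis r x y hx hy hr]
    · exact r'.1.symm (h1 y x hy hx (r.1.symm hr))
    · exact h1 x y hx hy hr
    · have h2 : (⟨y, hy⟩ : (Bᶜ : Set α)) ∈ {d : (Bᶜ : Set α) | r.1 x d} := hr
      have h3 := congrArg Prod.fst (congrFun h ⟨x, hx⟩)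
      simp only at h3
      rw [h3] at h2
      exact h2
  exact Subtype.ext (le_antisymm (key r r' h) (key r' r h.symm))

theorem Setoid.mk_setoid_le {α : Type u} (hα : Cardinal.aleph0 ≤ #α) : #(Setoid α) ≤ 2 ^ #α := by
  have h : #(Setoid α) ≤ #(Set (α × α)) := by
    refine Cardinal.mk_le_of_injective (f := fun r => {p | r p.1 p.2}) ?_
    intro r r' h
    ext x y
    exact Set.ext_iff.1 h (x, y)
  refine h.trans ?_
  simp [Cardinal.mul_eq_self hα]

/-! ### Cardinal arithmetic -/

theorem GCH.two_power_le (h : GCH.{u}) {c κ : Cardinal.{u}} (hκ : Cardinal.aleph0 ≤ κ)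
    (hc : c < κ) : 2 ^ c ≤ κ := by
  rcases lt_or_ge c Cardinal.aleph0 with h1 | h1
  · exact ((Cardinal.power_lt_aleph0 (Cardinal.natCast_lt_aleph0 (n := 2)) h1).trans_le hκ).le
  · rw [h c h1]
    exact Order.succ_le_of_lt hc

/-- A map from fewer than cf κ points into κ is bounded, so the maps split into κ pieces, one for
each bound, each of size at most κ by GCH. -/
theorem GCH.power_le (h : GCH.{u}) {c κ : Cardinal.{u}} (hκ : Cardinal.aleph0 ≤ κ)
    (hc : c < κ.ord.cof) : κ ^ c ≤ κ := by
  have hcκ : c < κ := hc.trans_le (Ordinal.cof_ord_le κ)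
  induction c using Cardinal.inductionOn with | _ M
  let K := κ.ord.ToType
  have hK : #K = κ := by simp [K]
  have hbd : (Set.univ : Set (M → K)) ⊆ ⋃ a : K, {f | ∀ m, f m < a} := by
    intro f _
    have hr : ¬ IsCofinal (Set.range f) := by
      intro hco
      have := Order.cof_le hco
      rw [Ordinal.cof_toType] at this
      exact absurd (this.trans Cardinal.mk_range_le) (not_le.2 hc)
    simp only [IsCofinal, not_forall, not_exists, not_and, not_le] at hr
    obtain ⟨a, ha⟩ := hr
    exact Set.mem_iUnion.2 ⟨a, fun m => ha _ ⟨m, rfl⟩⟩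
  have hpiece : ∀ a : K, #{f : M → K | ∀ m, f m < a} ≤ κ := by
    intro a
    have h1 : #{f : M → K | ∀ m, f m < a} ≤ #(M → Set.Iio a) :=
      Cardinal.mk_le_of_injective (f := fun f m => ⟨f.1 m, f.2 m⟩) (by
        intro f g hfg
        refine Subtype.ext (funext fun m => ?_)
        exact congrArg Subtype.val (congrFun hfg m))
    have h2 : #(Set.Iio a) < κ := (Cardinal.mk_Iio_lt a (by simp [K])).trans_eq hK
    rw [← Cardinal.power_def] at h1
    refine h1.trans ?_
    calc #(Set.Iio a) ^ #M ≤ (2 ^ #(Set.Iio a)) ^ #M :=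
          Cardinal.power_le_power_right (Cardinal.cantor _).le
      _ = 2 ^ (#(Set.Iio a) * #M) := (Cardinal.power_mul).symm
      _ ≤ κ := h.two_power_le hκ (Cardinal.mul_lt_of_lt hκ h2 hcκ)
  calc κ ^ #M = #(M → K) := by rw [← hK, Cardinal.power_def]
    _ = #(Set.univ : Set (M → K)) := Cardinal.mk_univ.symm
    _ ≤ #(⋃ a : K, {f : M → K | ∀ m, f m < a}) := Cardinal.mk_le_mk_of_subset hbd
    _ ≤ #K * ⨆ a : K, #{f : M → K | ∀ m, f m < a} := Cardinal.mk_iUnion_le _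
    _ ≤ κ * κ := by
      rw [hK]
      exact mul_le_mul_right (ciSup_le' hpiece) _
    _ = κ := Cardinal.mul_eq_self hκ

/-- A form of König's theorem: a product of sets whose cardinals are less than `κ` and unbounded
below `κ` has more than `κ` elements. -/
theorem Cardinal.lt_mk_pi_of_unbounded {ι : Type u} {β : ι → Type u} [∀ i, Nonempty (β i)]
    {κ : Cardinal.{u}} (hlt : ∀ i, #(β i) < κ) (hub : ∀ c < κ, ∃ i, c < #(β i)) :
    κ < #(∀ i, β i) := by
  classical
  rcases isEmpty_or_nonempty ι with he | ⟨⟨i₀⟩⟩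
  · have : κ = 0 := by
      by_contra h
      exact he.elim (hub 0 (pos_iff_ne_zero.2 h)).choose
    rw [this]
    simp
  let G : Cardinal.{u} → ι := fun c => if h : ∃ j, #(β j) = c then h.choose else i₀
  have hG : ∀ i, #(β (G #(β i))) = #(β i) := by
    intro i
    have h : ∃ j, #(β j) = #(β i) := ⟨i, rfl⟩
    simp only [G, dif_pos h]
    exact h.choose_spec
  have hnext : ∀ i, ∃ j, #(β i) < #(β j) ∧ ∀ k, #(β i) < #(β k) → #(β j) ≤ #(β k) := by
    intro i
    have hne : {k | #(β i) < #(β k)}.Nonempty := hub _ (hlt i)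
    let f : ι → Cardinal.{u} := fun k => #(β k)
    refine ⟨Function.argminOn f _ hne, Function.argminOn_mem f _ hne, fun k hk => ?_⟩
    exact Function.argminOn_le f _ hk
  -- `n i` indexes a factor of the next larger size.
  choose n hn1 hn2 using hnext
  -- One index is kept for each size. This makes `n` injective on `J`, so the full product maps onto
  -- the product of the `β (n j)`, which exceeds the sum of the `β j` by König.
  let J := {i : ι // G #(β i) = i}
  have hninj : Function.Injective fun j : J => n j.1 := by
    intro i j hij
    have hij : n i.1 = n j.1 := hij
    have aux : ∀ i j : J, n i.1 = n j.1 → #(β j.1) ≤ #(β i.1) := by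
      intro i j hij
      by_contra! h
      have h1 := hn2 i.1 j.1 h
      rw [hij] at h1
      exact absurd (hn1 j.1) (not_lt.2 h1)
    have h := le_antisymm (aux j i hij.symm) (aux i j hij)
    apply Subtype.ext
    rw [← i.2, ← j.2, h]
  have h1 : κ ≤ Cardinal.sum fun j : J => #(β j.1) := by
    by_contra! h
    obtain ⟨i, hi⟩ := hub _ h
    let j : J := ⟨G #(β i), by rw [hG]⟩
    have h2 : #(β j.1) ≤ Cardinal.sum fun j : J => #(β j.1) :=
      Cardinal.le_sum (fun j : J => #(β j.1)) j
    rw [hG] at h2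
    exact absurd hi (not_lt.2 h2)
  have h2 : (Cardinal.sum fun j : J => #(β j.1)) < Cardinal.prod fun j : J => #(β (n j.1)) :=
    Cardinal.sum_lt_prod _ _ fun j => hn1 j.1
  refine h1.trans_lt (h2.trans_le ?_)
  rw [← Cardinal.mk_pi]
  refine Cardinal.mk_le_of_surjective (f := fun t j => t (n j.1)) ?_
  intro x
  refine ⟨fun i => if h : ∃ j : J, n j.1 = i then h.choose_spec ▸ x h.choose
    else Classical.arbitrary _, ?_⟩
  funext j
  have h : ∃ j' : J, n j'.1 = n j.1 := ⟨j, rfl⟩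
  have aux : ∀ (j' : J) (e : n j'.1 = n j.1), (e ▸ x j' : β (n j.1)) = x j := by
    intro j' e
    obtain rfl := hninj e
    rfl
  simp only [dif_pos h]
  exact aux _ h.choose_spec

/-! ### The two cases of the theorem -/

theorem Setoid.lt_mk_complements {α : Type u} (s : Setoid α) (hs : s ≠ ⊤)
    (hα : Cardinal.aleph0 ≤ #α) (hq : #(Quotient s) < #α)
    (hb : ∀ b, #{x | s x b} ≠ #α) : #α < #s.complements := by
  have hb' : ∀ q : Quotient s, #{x : α // (⟦x⟧ : Quotient s) = q} < #α := by
    intro q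
    induction q using Quotient.inductionOn with | _ b
    refine lt_of_le_of_ne (Cardinal.mk_set_le _) fun h => hb b (h ▸ ?_)
    exact congrArg _ (congrArg _ (funext fun x => propext Quotient.eq.symm))
  have : ∀ q : Quotient s, Nonempty {x : α // (⟦x⟧ : Quotient s) = q} := fun q =>
    ⟨⟨q.out, q.out_eq⟩⟩
  refine (Cardinal.lt_mk_pi_of_unbounded hb' fun c hc => ?_).trans_le (s.mk_pi_le_complements hs)
  by_contra! h
  have h1 : #α ≤ #(Quotient s) * c := by
    calc #α = #(Σ q : Quotient s, {x : α // (⟦x⟧ : Quotient s) = q}) :=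
          (Cardinal.mk_congr (Equiv.sigmaFiberEquiv (Quotient.mk s))).symm
      _ = Cardinal.sum fun q : Quotient s => #{x : α // (⟦x⟧ : Quotient s) = q} :=
          Cardinal.mk_sigma _
      _ ≤ Cardinal.sum fun _ : Quotient s => c := Cardinal.sum_le_sum _ _ h
      _ = #(Quotient s) * c := by simp
  exact absurd (Cardinal.mul_lt_of_lt hα hq hc) (not_lt.2 h1)

theorem Setoid.mk_complements_eq_two_power (hGCH : GCH.{u}) {α : Type u}
    (hα : Cardinal.aleph0 ≤ #α) (s : Setoid α) (hbot : s ≠ ⊥) (htop : s ≠ ⊤)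
    (h : ∀ b, #{x | s x b} = #α → (#α).ord.cof ≤ #({x | s x b}ᶜ : Set α)) :
    #s.complements = 2 ^ #α := by
  refine le_antisymm ((Cardinal.mk_set_le _).trans (Setoid.mk_setoid_le hα)) ?_
  rcases (Cardinal.mk_quotient_le (s := s)).eq_or_lt with hq | hq
  · rw [← hq]
    exact s.two_power_mk_quotient_le_complements hbot (hq ▸ hα)
  rw [hGCH _ hα]
  refine Order.succ_le_of_lt ?_
  by_cases hB : ∃ b, #{x | s x b} = #α
  · obtain ⟨b, hb⟩ := hB
    refine ((Cardinal.lt_power_cof_ord hα).trans_le ?_).trans_le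
      (s.mk_power_mk_compl_le_complements b hα hb)
    exact Cardinal.power_le_power_left (Cardinal.aleph0_pos.trans_le hα).ne' (h b hb)
  · push Not at hB
    exact s.lt_mk_complements htop hα hq hB

theorem Setoid.mk_complements_eq_mk (hGCH : GCH.{u}) {α : Type u}
    (hα : Cardinal.aleph0 ≤ #α) (s : Setoid α) (htop : s ≠ ⊤) (b : α)
    (hb : #{x | s x b} = #α) (hc : #({x | s x b}ᶜ : Set α) < (#α).ord.cof) :
    #s.complements = #α := by
  refine le_antisymm ((s.mk_complements_le b).trans ?_) ?_
  · have hcα := hc.trans_le (Ordinal.cof_ord_le _)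
    refine le_trans (Cardinal.power_le_power_right ?_) (hGCH.power_le hα hc)
    rw [Cardinal.add_one_eq hα]
    exact (mul_le_mul_left (hGCH.two_power_le hα hcα) _).trans (Cardinal.mul_eq_self hα).le
  · refine le_trans ?_ (s.mk_power_mk_compl_le_complements b hα hb)
    apply Cardinal.self_le_power
    rw [Cardinal.one_le_iff_ne_zero, Cardinal.mk_ne_zero_iff, Set.nonempty_coe_sort,
      Set.nonempty_compl]
    intro hu
    rw [Set.eq_univ_iff_forall] at hu
    exact htop (Setoid.eq_top_iff.2 fun x y => s.trans (hu x) (s.symm (hu y)))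

theorem mainTheorem9 (hGCH : GCH.{u}) (κ : Cardinal.{u}) (hκ : Cardinal.aleph0 ≤ κ)
    (α : Type u) (hα : Cardinal.mk α = κ) (P : Setoid.Partitions α) (hbot : P ≠ ⊥) (htop : P ≠ ⊤) :
    (Cardinal.mk (complements P) = κ ↔
      ∃ B : Set α, (B ∈ P.toSet ∧ Cardinal.mk B = κ) ∧
        (∀ C : Set α, C ∈ P.toSet ∧ Cardinal.mk C = κ → C = B) ∧
        Cardinal.mk (Bᶜ : Set α) < κ.ord.cof) ∧
    ((¬ ∃ B : Set α, (B ∈ P.toSet ∧ Cardinal.mk B = κ) ∧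
        (∀ C : Set α, C ∈ P.toSet ∧ Cardinal.mk C = κ → C = B) ∧
        Cardinal.mk (Bᶜ : Set α) < κ.ord.cof) →
      Cardinal.mk (complements P) = 2 ^ κ) := by
  subst hα
  obtain ⟨s, rfl⟩ := (Setoid.Partition.orderIso α).surjective P
  rw [mk_complements_eq, OrderIso.symm_apply_apply]
  have hs : s ≠ ⊥ := by
    rintro rfl
    exact hbot (Setoid.Partition.orderIso α).map_bot
  have hs' : s ≠ ⊤ := by
    rintro rfl
    exact htop (Setoid.Partition.orderIso α).map_top
  have hmem : ∀ b, {x | s x b} ∈ (Setoid.Partition.orderIso α s).toSet := fun b => ⟨b, rfl⟩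
  have h2 : (¬ ∃ B : Set α, (B ∈ (Setoid.Partition.orderIso α s).toSet ∧ #B = #α) ∧
        (∀ C : Set α, C ∈ (Setoid.Partition.orderIso α s).toSet ∧ #C = #α → C = B) ∧
        #(Bᶜ : Set α) < (#α).ord.cof) → #s.complements = 2 ^ #α := by
    intro hno
    refine s.mk_complements_eq_two_power hGCH hκ hs hs' fun b hb => ?_
    by_contra! hlt
    refine hno ⟨{x | s x b}, ⟨hmem b, hb⟩, ?_, hlt⟩
    rintro C ⟨⟨c, rfl⟩, hC⟩
    by_contra hne
    -- A second block of size κ would lie in the complement of the first, which has fewer than cf κ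
    -- ≤ κ points.
    have hsub : {x | s x c} ⊆ {x | s x b}ᶜ := by
      intro x hxc hxb
      have hcb : s c b := s.trans (s.symm hxc) hxb
      exact hne (Set.ext fun y => ⟨fun h => s.trans h hcb, fun h => s.trans h (s.symm hcb)⟩)
    have h1 := Cardinal.mk_le_mk_of_subset hsub
    rw [hC] at h1
    exact absurd (hlt.trans_le (Ordinal.cof_ord_le _)) (not_lt.2 h1)
  refine ⟨⟨fun h => ?_, ?_⟩, h2⟩
  · by_contra hno
    rw [h2 hno] at h
    exact (Cardinal.cantor #α).ne' h
  · rintro ⟨_, ⟨⟨b, rfl⟩, hb⟩, -, hc⟩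
    exact s.mk_complements_eq_mk hGCH hκ hs' b hb hc
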